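/- Let $k$ be a field and let $m\ge 2$ be an integer. Put $n_1=m(m+1)$, $n_2=m(m+1)+1$, $n_3=(m+1)^2$, $n_4=(m+1)^2+1$, let $\mathfrak S_m=\langle n_1,n_2,n_3,n_4\rangle\subseteq\mathbb N$ be the semigroup they generate, let $R=k[[t^{n_1},t^{n_2},t^{n_3},t^{n_4}]]$ with maximal ideal $\mathfrak m$, and let $I=(t^{n_1})\subseteq R$. Let $F(I)=\bigoplus_{n\ge 0}I^n/\mathfrak m I^n$ be the fiber cone of $I$, and let $G_{\mathfrak m}(\mathfrak S_m)=\bigoplus_{n\ge 0}\mathfrak m^n/\mathfrak m^{n+1}$ be the tangent cone, which is a graded $F(I)$-module via the natural map $F(I)\to G_{\mathfrak m}(\mathfrak S_m)$ induced by the inclusions $I^n\subseteq\mathfrak m^n$. Then $G_{\mathfrak m}(\mathfrak S_m)$ is a free $F(I)$-module. Moreover, there is an isomorphism of graded $F(I)$-modules $$G_{\mathfrak m}(\mathfrak S_m)\;\cong\;\bigoplus_{d=0}^{m-1}\bigl(F(I)(-d)\bigr)^{2d+1}\;\oplus\;\bigl(F(I)(-m)\bigr)^{m},$$ where $F(I)(-d)$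 denotes the shifted module with $F(I)(-d)_n=F(I)_{n-d}$. -/

import Mathlib

open Polynomial

/-- The subring `k[[S]]` of `k[[t]]` of a semigroup `S` of natural numbers: all power series in `t`
whose support lies in `S`. If `S` is generated by positive integers `a₁, …, aₑ`, this is
`k[[t^a₁, …, t^aₑ]]`. -/
def semigroupRing (k : Type*) [Field k] (S : AddSubmonoid ℕ) : Subalgebra k (PowerSeries k) where
  carrier := {f | ∀ n, PowerSeries.coeff n f ≠ 0 → n ∈ S}
  mul_mem' := by
    intro f g hf hg n hn
    rw [PowerSeries.coeff_mul] at hn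
    obtain ⟨p, hp, hne⟩ := Finset.exists_ne_zero_of_sum_ne_zero hn
    rw [← Finset.HasAntidiagonal.mem_antidiagonal.mp hp]
    exact S.add_mem (hf _ (left_ne_zero_of_mul hne)) (hg _ (right_ne_zero_of_mul hne))
  add_mem' := by
    intro f g hf hg n hn
    by_cases h : PowerSeries.coeff n f = 0
    · exact hg n (by simpa [h] using hn)
    · exact hf n h
  algebraMap_mem' := by
    intro r n hn
    by_cases h : n = 0
    · rw [h]
      exact S.zero_mem
    · exact absurd (by simp [PowerSeries.coeff_C, h]) hn

/-- The element `t^s` of `k[[S]]`, for `s ∈ S`. -/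
noncomputable def semigroupRing.tpow (k : Type*) [Field k] (S : AddSubmonoid ℕ) (s : ℕ)
    (hs : s ∈ S) : semigroupRing k S :=
  ⟨PowerSeries.X ^ s, by
    intro n hn
    by_cases h : n = s
    · rw [h]
      exact hs
    · exact absurd (by simp [PowerSeries.coeff_X_pow, h]) hn⟩

theorem semigroupRing.inv_mem {k : Type*} [Field k] {S : AddSubmonoid ℕ} {f : PowerSeries k}
    (hf : f ∈ semigroupRing k S) : f⁻¹ ∈ semigroupRing k S := by
  intro n
  induction n using Nat.strong_induction_on with
  | _ n ih =>
    intro hn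
    by_cases h : n = 0
    · rw [h]
      exact S.zero_mem
    · rw [PowerSeries.coeff_inv, if_neg h] at hn
      obtain ⟨p, hp, hne⟩ := Finset.exists_ne_zero_of_sum_ne_zero (right_ne_zero_of_mul hn)
      by_cases hlt : p.2 < n
      · rw [if_pos hlt] at hne
        rw [← Finset.HasAntidiagonal.mem_antidiagonal.mp hp]
        exact S.add_mem (hf _ (left_ne_zero_of_mul hne)) (ih _ hlt (right_ne_zero_of_mul hne))
      · exact absurd (if_neg hlt) hne

instance semigroupRing.isLocalHom_val (k : Type*) [Field k] (S : AddSubmonoid ℕ) :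
    IsLocalHom (semigroupRing k S).val.toRingHom := by
  refine ⟨fun f hf => ?_⟩
  have h0 : PowerSeries.constantCoeff (f : PowerSeries k) ≠ 0 :=
    ((PowerSeries.isUnit_iff_constantCoeff).mp hf).ne_zero
  exact IsUnit.of_mul_eq_one ⟨(f : PowerSeries k)⁻¹, semigroupRing.inv_mem f.2⟩
    (Subtype.ext (PowerSeries.mul_inv_cancel _ h0))

/-- `k[[S]]` is a local ring. -/
instance semigroupRing.isLocalRing (k : Type*) [Field k] (S : AddSubmonoid ℕ) :
    IsLocalRing (semigroupRing k S) :=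
  RingHom.domain_isLocalRing (semigroupRing k S).val.toRingHom

/-- For ideals `I`, `J` of `R`, the graded ring `⨁ₙ Iⁿ / J Iⁿ`, as the quotient of the Rees algebra
`R[It] = ⨁ₙ Iⁿ tⁿ ⊆ R[t]` by the extension `J R[It] = ⨁ₙ J Iⁿ tⁿ` of `J`. -/
def ReesQuotient {R : Type*} [CommRing R] (J I : Ideal R) : Type _ :=
  reesAlgebra I ⧸ J.map (algebraMap R (reesAlgebra I))

theorem reesAlgebra_le_of_le {R : Type*} [CommRing R] {I I' : Ideal R} (h : I ≤ I') :
    reesAlgebra I ≤ reesAlgebra I' := by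
  intro f hf
  rw [mem_reesAlgebra_iff] at hf ⊢
  exact fun n => Ideal.pow_right_mono h n (hf n)

namespace ReesQuotient

variable {R : Type*} [CommRing R]

noncomputable instance (J I : Ideal R) : CommRing (ReesQuotient J I) :=
  inferInstanceAs (CommRing (reesAlgebra I ⧸ J.map (algebraMap R (reesAlgebra I))))

noncomputable instance (J I : Ideal R) : Algebra R (ReesQuotient J I) :=
  inferInstanceAs (Algebra R (reesAlgebra I ⧸ J.map (algebraMap R (reesAlgebra I))))

/-- The quotient map from the Rees algebra. -/
noncomputable def mk (J I : Ideal R) : reesAlgebra I →ₐ[R] ReesQuotient J I :=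
  Ideal.Quotient.mkₐ R (J.map (algebraMap R (reesAlgebra I)))

/-- The homogeneous component of degree `n` of `⨁ₙ Iⁿ / J Iⁿ`, that is the image of `Iⁿ tⁿ`;
it is zero for `n < 0`. -/
noncomputable def component (J I : Ideal R) (n : ℤ) : AddSubgroup (ReesQuotient J I) :=
  if 0 ≤ n then
    (((LinearMap.range (monomial (R := R) n.toNat)).comap (reesAlgebra I).val.toLinearMap).map
      (mk J I).toLinearMap).toAddSubgroup
  else ⊥

/-- The natural homomorphism `⨁ₙ Iⁿ / J Iⁿ → ⨁ₙ I'ⁿ / J I'ⁿ` for ideals `I ⊆ I'`, induced by the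
inclusions `Iⁿ ⊆ I'ⁿ`. -/
noncomputable def map (J : Ideal R) {I I' : Ideal R} (h : I ≤ I') :
    ReesQuotient J I →ₐ[R] ReesQuotient J I' :=
  Ideal.Quotient.liftₐ (J.map (algebraMap R (reesAlgebra I)))
    ((mk J I').comp (Subalgebra.inclusion (reesAlgebra_le_of_le h))) (by
      intro a ha
      have hle : J.map (algebraMap R (reesAlgebra I)) ≤ RingHom.ker
          ((mk J I').comp (Subalgebra.inclusion (reesAlgebra_le_of_le h))).toRingHom := by
        rw [Ideal.map_le_iff_le_comap]
        intro r hr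
        have h1 : algebraMap R (reesAlgebra I') r ∈ J.map (algebraMap R (reesAlgebra I')) :=
          Ideal.mem_map_of_mem _ hr
        have h2 : mk J I' (algebraMap R (reesAlgebra I') r) = 0 :=
          Ideal.Quotient.eq_zero_iff_mem.mpr h1
        rw [Ideal.mem_comap, RingHom.mem_ker]
        simpa using h2
      exact hle ha)

end ReesQuotient

/-- The fiber cone `F(I) = ⨁ₙ Iⁿ / 𝔪 Iⁿ` of an ideal `I` of a local ring `(R, 𝔪)`. -/
abbrev FiberCone {R : Type*} [CommRing R] [IsLocalRing R] (I : Ideal R) : Type _ :=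
  ReesQuotient (IsLocalRing.maximalIdeal R) I

/-- The tangent cone `G_𝔪 = ⨁ₙ 𝔪ⁿ / 𝔪ⁿ⁺¹` of a local ring `(R, 𝔪)`. -/
abbrev TangentCone (R : Type*) [CommRing R] [IsLocalRing R] : Type _ :=
  ReesQuotient (IsLocalRing.maximalIdeal R) (IsLocalRing.maximalIdeal R)

/-- The grading of the fiber cone of `I`. -/
noncomputable abbrev FiberCone.component {R : Type*} [CommRing R] [IsLocalRing R] (I : Ideal R) :
    ℤ → AddSubgroup (FiberCone I) :=
  ReesQuotient.component (IsLocalRing.maximalIdeal R) I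

/-- The grading of the tangent cone of `R`. -/
noncomputable abbrev TangentCone.component (R : Type*) [CommRing R] [IsLocalRing R] :
    ℤ → AddSubgroup (TangentCone R) :=
  ReesQuotient.component (IsLocalRing.maximalIdeal R) (IsLocalRing.maximalIdeal R)

/-- For an ideal `I ⊆ 𝔪`, the tangent cone as an algebra, hence a module, over the fiber cone of
`I`, by the natural homomorphism `⨁ₙ Iⁿ / 𝔪 Iⁿ → ⨁ₙ 𝔪ⁿ / 𝔪ⁿ⁺¹`. -/
noncomputable abbrev TangentCone.algebraFiberCone {R : Type*} [CommRing R] [IsLocalRing R]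
    {I : Ideal R} (h : I ≤ IsLocalRing.maximalIdeal R) : Algebra (FiberCone I) (TangentCone R) :=
  (ReesQuotient.map (IsLocalRing.maximalIdeal R) h).toRingHom.toAlgebra

/-- The shift `M(a)` of a graded module: `M(a)ₙ = Mₙ₊ₐ`. -/
def gradingShift {M : Type*} [AddCommGroup M] (𝓜 : ℤ → AddSubgroup M) (a : ℤ) :
    ℤ → AddSubgroup M :=
  fun n => 𝓜 (n + a)

/-- The grading of a direct sum of graded modules over a (finite) index type. -/
def gradingPi {ι : Type*} {M : ι → Type*} [∀ i, AddCommGroup (M i)]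
    (𝓜 : ∀ i, ℤ → AddSubgroup (M i)) : ℤ → AddSubgroup (∀ i, M i) :=
  fun n => AddSubgroup.pi Set.univ fun i => 𝓜 i n

/-- The grading of a direct sum of two graded modules. -/
def gradingProd {M N : Type*} [AddCommGroup M] [AddCommGroup N]
    (𝓜 : ℤ → AddSubgroup M) (𝓝 : ℤ → AddSubgroup N) : ℤ → AddSubgroup (M × N) :=
  fun n => (𝓜 n).prod (𝓝 n)

/-- An isomorphism of graded `A`-modules: an `A`-linear bijection that matches the homogeneous
components of each degree. -/
structure GradedModuleEquiv (A : Type*) [CommRing A] {M N : Type*} [AddCommGroup M]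
    [AddCommGroup N] [Module A M] [Module A N] (𝓜 : ℤ → AddSubgroup M) (𝓝 : ℤ → AddSubgroup N)
    extends M ≃ₗ[A] N where
  mem_iff : ∀ (n : ℤ) (x : M), toFun x ∈ 𝓝 n ↔ x ∈ 𝓜 n

/-- The semigroup `⟨m(m+1), m(m+1)+1, (m+1)², (m+1)²+1⟩`. -/
def arslanSemigroup (m : ℕ) : AddSubmonoid ℕ :=
  AddSubmonoid.closure {m * (m + 1), m * (m + 1) + 1, (m + 1) ^ 2, (m + 1) ^ 2 + 1}

/-- The local ring `k[[t^n₁, t^n₂, t^n₃, t^n₄]]` of the Arslan curve. -/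
abbrev ArslanRing (k : Type*) [Field k] (m : ℕ) : Type _ :=
  semigroupRing k (arslanSemigroup m)

/-- The ideal `I = (t^n₁)` of the local ring of the Arslan curve, where `n₁ = m(m+1)`. -/
noncomputable def arslanIdeal (k : Type*) [Field k] (m : ℕ) : Ideal (ArslanRing k m) :=
  Ideal.span {semigroupRing.tpow k (arslanSemigroup m) (m * (m + 1))
    (AddSubmonoid.subset_closure (by simp))}

theorem arslanIdeal_le (k : Type*) [Field k] {m : ℕ} (hm : 2 ≤ m) :
    arslanIdeal k m ≤ IsLocalRing.maximalIdeal (ArslanRing k m) := by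
  rw [arslanIdeal, Ideal.span_singleton_le_iff_mem, IsLocalRing.mem_maximalIdeal, mem_nonunits_iff]
  intro h
  have h1 := h.map (semigroupRing k (arslanSemigroup m)).val
  have h2 := (PowerSeries.isUnit_iff_constantCoeff).mp h1
  have h3 : m * (m + 1) ≠ 0 := by positivity
  simp [semigroupRing.tpow, h3] at h2

/-! Every natural number is uniquely `n m(m+1) + q(m+1) + p` with `p ≤ m` and `q < m`, and it lies
in the semigroup iff `max p q ≤ n` (`arslanNumber_mem_iff`). Any semigroup element with `n ≥ 1`
splits off a generator and leaves an element whose leading digit is `n - 1`, so `𝔪ⁿ` consists of the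
series of order at least `n n₁` (`mem_maximalIdeal_pow_iff`). Hence `𝔪ⁿ/𝔪ⁿ⁺¹` has as a `k`-basis the
`t^s` with leading digit `n` and `max p q ≤ n`.

Multiplication by `t^n₁` raises `n` and keeps `(p, q)`, while `F(I)` has one basis vector `t^(n n₁)`
in each degree `n`. So each pair `(p, q)` spans a free rank-one summand starting in degree `max p
q`. There are `2d + 1` pairs with maximum `d < m`, and `m` pairs with maximum `m`.

Both graded rings are handled through coefficients of power series. In these coordinates the
combination map is diagonal (`coeff_sum_mul_reesBasis`), which gives bijectivity and the matching of
degrees. -/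

/-! ### Membership and grading in quotients of Rees algebras. -/

namespace ReesQuotient

variable {R : Type*} [CommRing R]

theorem mk_surjective (J I : Ideal R) : Function.Surjective (mk J I) :=
  Ideal.Quotient.mk_surjective

theorem monomial_mem_map_algebraMap (J I : Ideal R) (n : ℕ) {a : R} (ha : a ∈ J * I ^ n)
    (h : monomial n a ∈ reesAlgebra I) :
    (⟨monomial n a, h⟩ : reesAlgebra I) ∈ J.map (algebraMap R (reesAlgebra I)) := by
  -- The membership proof moves into the goal so that the induction can rebuild it for each summand.
  suffices H : ∃ h' : monomial n a ∈ reesAlgebra I,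
      (⟨monomial n a, h'⟩ : reesAlgebra I) ∈ J.map (algebraMap R (reesAlgebra I)) from H.2
  clear h
  induction ha using Submodule.mul_induction_on' with
  | mem_mul_mem j hj b hb =>
    have hb' : monomial n b ∈ reesAlgebra I := reesAlgebra.monomial_mem.mpr hb
    have h1 := Ideal.mul_mem_right (⟨monomial n b, hb'⟩ : reesAlgebra I) _
      (Ideal.mem_map_of_mem (algebraMap R (reesAlgebra I)) hj)
    have h2 : ((algebraMap R (reesAlgebra I) j * ⟨monomial n b, hb'⟩ : reesAlgebra I) : R[X])
        = monomial n (j * b) := by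
      simp [← Polynomial.C_mul_monomial]
    exact ⟨h2 ▸ Subtype.prop _, by convert h1 using 1; exact Subtype.ext h2.symm⟩
  | add a _ b _ iha ihb =>
    obtain ⟨h1, h2⟩ := iha
    obtain ⟨h3, h4⟩ := ihb
    refine ⟨by rw [map_add]; exact add_mem h1 h3, ?_⟩
    convert add_mem h2 h4 using 1
    exact Subtype.ext (map_add _ _ _)

/-- The extension of `J` to the Rees algebra of `I` is `⨁ₙ J Iⁿ tⁿ`. -/
theorem mk_eq_zero_iff (J I : Ideal R) (f : reesAlgebra I) :
    mk J I f = 0 ↔ ∀ n, (f : R[X]).coeff n ∈ J * I ^ n := by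
  have h0 : mk J I f = 0 ↔ f ∈ J.map (algebraMap R (reesAlgebra I)) :=
    Ideal.Quotient.eq_zero_iff_mem
  rw [h0]
  constructor
  · intro hf
    rw [Ideal.map] at hf
    refine Submodule.span_induction
      (p := fun (g : reesAlgebra I) _ => ∀ n, (g : R[X]).coeff n ∈ J * I ^ n) ?_ ?_ ?_ ?_ hf
    · rintro _ ⟨j, hj, rfl⟩ n
      have h1 : ((algebraMap R (reesAlgebra I) j : reesAlgebra I) : R[X]) = C j := rfl
      rw [h1, coeff_C]
      split_ifs with h
      · subst h
        simpa using hj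
      · exact zero_mem _
    · intro n
      simp
    · intro a b _ _ ha hb n
      simpa using add_mem (ha n) (hb n)
    · intro a b _ hb n
      rw [smul_eq_mul, Subalgebra.coe_mul, coeff_mul]
      refine sum_mem fun p hp => ?_
      rw [← Finset.HasAntidiagonal.mem_antidiagonal.mp hp, pow_add, mul_left_comm]
      exact Ideal.mul_mem_mul ((mem_reesAlgebra_iff I _).mp a.2 p.1) (hb p.2)
  · intro hf
    have h1 : ∀ n, monomial n ((f : R[X]).coeff n) ∈ reesAlgebra I := fun n =>
      reesAlgebra.monomial_mem.mpr ((mem_reesAlgebra_iff I _).mp f.2 n)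
    have h2 : f = ∑ n ∈ (f : R[X]).support,
        (⟨monomial n ((f : R[X]).coeff n), h1 n⟩ : reesAlgebra I) := by
      refine Subtype.ext ?_
      rw [AddSubmonoidClass.coe_finsetSum]
      exact (f : R[X]).as_sum_support
    rw [h2]
    exact sum_mem fun n _ => monomial_mem_map_algebraMap J I n (hf n) (h1 n)

theorem mk_eq_mk_iff (J I : Ideal R) (f g : reesAlgebra I) :
    mk J I f = mk J I g ↔ ∀ n, (f : R[X]).coeff n - (g : R[X]).coeff n ∈ J * I ^ n := by
  rw [← sub_eq_zero, ← map_sub, mk_eq_zero_iff]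
  simp

theorem mk_mem_component_iff (J I : Ideal R) (N : ℤ) (f : reesAlgebra I) :
    mk J I f ∈ component J I N ↔
      ∀ n : ℕ, (n : ℤ) ≠ N → (f : R[X]).coeff n ∈ J * I ^ n := by
  unfold component
  split_ifs with hN
  · constructor
    · rintro ⟨g, ⟨a, ha⟩, hg⟩ n hn
      have h1 := (mk_eq_mk_iff J I f g).mp hg.symm n
      have h2 : (g : R[X]).coeff n = 0 := by
        change monomial N.toNat a = (g : R[X]) at ha
        rw [← ha, coeff_monomial, if_neg (by omega)]
      rwa [h2, sub_zero] at h1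
    · intro h
      refine ⟨⟨monomial N.toNat ((f : R[X]).coeff N.toNat),
        reesAlgebra.monomial_mem.mpr ((mem_reesAlgebra_iff I _).mp f.2 _)⟩, ⟨_, rfl⟩, ?_⟩
      refine ((mk_eq_mk_iff J I f _).mpr fun n => ?_).symm
      rw [coeff_monomial]
      split_ifs with hn
      · subst hn
        simp
      · simpa using h n (by omega)
  · rw [AddSubgroup.mem_bot, mk_eq_zero_iff]
    -- For negative `N` the condition `n ≠ N` always holds, so both sides express vanishing.
    exact forall_congr' fun n => ⟨fun h _ => h, fun h => h (by omega)⟩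

end ReesQuotient

/-! ### Mixed-radix digits and membership in the semigroup. -/

/-- The number `d m (m + 1) + q (m + 1) + p`; for `p, q ≤ d` these are the sums of `d` of the four
generators of `arslanSemigroup m`. -/
def arslanNumber (m d p q : ℕ) : ℕ := (d * m + q) * (m + 1) + p

theorem arslanNumber_inj {m n p q n' p' q' : ℕ} (hp : p ≤ m) (hq : q < m) (hp' : p' ≤ m)
    (hq' : q' < m) (h : arslanNumber m n p q = arslanNumber m n' p' q') :
    n = n' ∧ p = p' ∧ q = q' := by
  unfold arslanNumber at h
  have h1 := congrArg (· % (m + 1)) h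
  have h2 := congrArg (· / (m + 1)) h
  simp only [Nat.mul_add_mod_of_lt (Nat.lt_succ_of_le hp),
    Nat.mul_add_mod_of_lt (Nat.lt_succ_of_le hp')] at h1
  rw [Nat.mul_comm, Nat.mul_comm (n' * m + q')] at h2
  simp only [Nat.mul_add_div (Nat.succ_pos m), Nat.div_eq_of_lt (Nat.lt_succ_of_le hp),
    Nat.div_eq_of_lt (Nat.lt_succ_of_le hp'), add_zero] at h2
  have h3 := congrArg (· % m) h2
  have h4 := congrArg (· / m) h2
  simp only [Nat.mul_add_mod', Nat.mod_eq_of_lt hq, Nat.mod_eq_of_lt hq'] at h3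
  rw [Nat.mul_comm, Nat.mul_comm n'] at h4
  simp only [Nat.mul_add_div (Nat.zero_lt_of_lt hq), Nat.div_eq_of_lt hq, Nat.div_eq_of_lt hq',
    add_zero] at h4
  exact ⟨h4, h1, h3⟩

/-- The lower digits contribute `q(m+1) + p < m(m+1)`, so size is decided by the leading digit. -/
theorem arslanNumber_lt_iff {m n p q : ℕ} (hp : p ≤ m) (hq : q < m) (N : ℕ) :
    arslanNumber m n p q < N * (m * (m + 1)) ↔ n < N := by
  unfold arslanNumber
  constructor
  · intro h
    by_contra hN
    have h1 : N * (m * (m + 1)) ≤ n * (m * (m + 1)) := Nat.mul_le_mul_right _ (not_lt.mp hN)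
    nlinarith
  · intro h
    have h1 : (n + 1) * (m * (m + 1)) ≤ N * (m * (m + 1)) := Nat.mul_le_mul_right _ h
    have h2 : (q + 1) * (m + 1) ≤ m * (m + 1) := Nat.mul_le_mul_right _ hq
    nlinarith

theorem exists_eq_arslanNumber {m : ℕ} (hm : 0 < m) (s : ℕ) :
    ∃ n p q, p ≤ m ∧ q < m ∧ s = arslanNumber m n p q := by
  refine ⟨s / (m + 1) / m, s % (m + 1), s / (m + 1) % m,
    Nat.le_of_lt_succ (Nat.mod_lt _ (Nat.succ_pos m)), Nat.mod_lt _ hm, ?_⟩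
  rw [arslanNumber, Nat.div_add_mod', Nat.div_add_mod']

/-- The four generators of `arslanSemigroup m`. -/
def arslanGenerators (m : ℕ) : Finset ℕ :=
  {m * (m + 1), m * (m + 1) + 1, (m + 1) ^ 2, (m + 1) ^ 2 + 1}

theorem mem_arslanSemigroup_of_mem_generators {m g : ℕ} (hg : g ∈ arslanGenerators m) :
    g ∈ arslanSemigroup m :=
  AddSubmonoid.subset_closure (by simpa [arslanGenerators] using hg)

/-- The generators are the numbers with `d = 1` and `p, q ∈ {0, 1}`. Subtracting one lowers `p` or
`q` exactly when it has the extreme value `j + 1`. -/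
theorem exists_arslanNumber_succ_eq {m j p q : ℕ} (hp : p ≤ j + 1) (hq : q ≤ j + 1) :
    ∃ g ∈ arslanGenerators m, ∃ p' ≤ j, ∃ q' ≤ j,
      arslanNumber m (j + 1) p q = g + arslanNumber m j p' q' := by
  unfold arslanNumber
  rcases hp.lt_or_eq with hp | rfl <;> rcases hq.lt_or_eq with hq | rfl
  · exact ⟨m * (m + 1), by simp [arslanGenerators], p, by omega, q, by omega, by ring⟩
  · exact ⟨(m + 1) ^ 2, by simp [arslanGenerators], p, by omega, j, le_rfl, by ring⟩
  · exact ⟨m * (m + 1) + 1, by simp [arslanGenerators], j, le_rfl, q, by omega, by ring⟩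
  · exact ⟨(m + 1) ^ 2 + 1, by simp [arslanGenerators], j, le_rfl, j, le_rfl, by ring⟩

theorem arslanNumber_mem {m d p q : ℕ} (hp : p ≤ d) (hq : q ≤ d) :
    arslanNumber m d p q ∈ arslanSemigroup m := by
  induction d generalizing p q with
  | zero =>
    obtain rfl : p = 0 := by omega
    obtain rfl : q = 0 := by omega
    simp [arslanNumber]
  | succ d ih =>
    obtain ⟨g, hg, p', hp', q', hq', h⟩ := exists_arslanNumber_succ_eq (m := m) hp hq
    rw [h]
    exact add_mem (mem_arslanSemigroup_of_mem_generators hg) (ih hp' hq')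

theorem exists_of_mem_arslanSemigroup {m s : ℕ} (hs : s ∈ arslanSemigroup m) :
    ∃ d p q, p ≤ d ∧ q ≤ d ∧ s = arslanNumber m d p q := by
  unfold arslanNumber
  induction hs using AddSubmonoid.closure_induction with
  | mem x hx =>
    rcases hx with rfl | rfl | rfl | rfl
    · exact ⟨1, 0, 0, by omega, by omega, by ring⟩
    · exact ⟨1, 1, 0, by omega, by omega, by ring⟩
    · exact ⟨1, 0, 1, by omega, by omega, by ring⟩
    · exact ⟨1, 1, 1, by omega, by omega, by ring⟩
  | zero => exact ⟨0, 0, 0, le_rfl, le_rfl, by ring⟩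
  | add x y _ _ hx hy =>
    obtain ⟨d, p, q, hp, hq, rfl⟩ := hx
    obtain ⟨d', p', q', hp', hq', rfl⟩ := hy
    exact ⟨d + d', p + p', q + q', by omega, by omega, by ring⟩

/-- For `n ≥ m` the bounds are automatic. For `n < m`, comparing sizes shows that a sum of
generators equal to this number has at most `n` terms; its `p'` and `q'` are then below `m`, hence
genuine digits, and uniqueness applies. -/
theorem arslanNumber_mem_iff {m n p q : ℕ} (hp : p ≤ m) (hq : q < m) :
    arslanNumber m n p q ∈ arslanSemigroup m ↔ p ≤ n ∧ q ≤ n := by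
  refine ⟨fun h => ?_, fun h => arslanNumber_mem h.1 h.2⟩
  obtain ⟨d, p', q', hp', hq', h⟩ := exists_of_mem_arslanSemigroup h
  rcases le_or_gt m n with hmn | hmn
  · omega
  have hdn : d < n + 1 := by
    by_contra hd
    have h1 := (arslanNumber_lt_iff (n := n) hp hq (n + 1)).mpr (Nat.lt_succ_self n)
    have h2 : (n + 1) * (m * (m + 1)) ≤ d * (m * (m + 1)) := Nat.mul_le_mul_right _ (not_lt.mp hd)
    have h3 : d * (m * (m + 1)) ≤ arslanNumber m d p' q' := by
      unfold arslanNumber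
      nlinarith
    omega
  obtain ⟨rfl, rfl, rfl⟩ := arslanNumber_inj hp hq (by omega) (by omega) h
  exact ⟨hp', hq'⟩

theorem eq_zero_of_mem_arslanSemigroup_of_lt {m s : ℕ} (hm : 0 < m) (hs : s ∈ arslanSemigroup m)
    (hlt : s < m * (m + 1)) : s = 0 := by
  obtain ⟨j, p, q, hp, hq, rfl⟩ := exists_eq_arslanNumber hm s
  have h2 := (arslanNumber_lt_iff hp hq 1).mp (by simpa using hlt)
  have h3 := (arslanNumber_mem_iff hp hq).mp hs
  obtain rfl : j = 0 := by omega
  obtain rfl : p = 0 := by omega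
  obtain rfl : q = 0 := by omega
  simp [arslanNumber]

theorem exists_generator_add {m n s : ℕ} (hm : 0 < m) (hs : s ∈ arslanSemigroup m)
    (hn : (n + 1) * (m * (m + 1)) ≤ s) :
    ∃ g ∈ arslanGenerators m, ∃ u ∈ arslanSemigroup m, n * (m * (m + 1)) ≤ u ∧ s = g + u := by
  obtain ⟨j, p, q, hp, hq, rfl⟩ := exists_eq_arslanNumber hm s
  have h1 := (arslanNumber_mem_iff hp hq).mp hs
  have h2 : n + 1 ≤ j := by
    by_contra h
    exact absurd ((arslanNumber_lt_iff hp hq (n + 1)).mpr (not_le.mp h)) (not_lt.mpr hn)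
  obtain ⟨j, rfl⟩ : ∃ i, j = i + 1 := ⟨j - 1, by omega⟩
  obtain ⟨g, hg, p', hp', q', hq', h⟩ := exists_arslanNumber_succ_eq (m := m) h1.1 h1.2
  refine ⟨g, hg, _, arslanNumber_mem hp' hq', ?_, h⟩
  have h3 : n * (m * (m + 1)) ≤ j * (m * (m + 1)) := Nat.mul_le_mul_right _ (by omega)
  unfold arslanNumber
  nlinarith

/-! ### Powers of the two ideals in terms of coefficients. -/

theorem semigroupRing.mem_maximalIdeal_iff {k : Type*} [Field k] {S : AddSubmonoid ℕ}
    (f : semigroupRing k S) :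
    f ∈ IsLocalRing.maximalIdeal (semigroupRing k S) ↔
      PowerSeries.coeff 0 (f : PowerSeries k) = 0 := by
  have h1 : IsUnit f ↔ IsUnit (f : PowerSeries k) :=
    (isUnit_map_iff (semigroupRing k S).val.toRingHom f).symm
  rw [IsLocalRing.mem_maximalIdeal, mem_nonunits_iff, h1, PowerSeries.isUnit_iff_constantCoeff,
    isUnit_iff_ne_zero, not_not, PowerSeries.coeff_zero_eq_constantCoeff_apply]

namespace ArslanRing

variable {k : Type*} [Field k] {m : ℕ}

theorem coeff_eq_zero_of_mem_maximalIdeal_pow (hm : 0 < m) {n : ℕ} {f : ArslanRing k m}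
    (hf : f ∈ IsLocalRing.maximalIdeal (ArslanRing k m) ^ n) {s : ℕ}
    (hs : s < n * (m * (m + 1))) : PowerSeries.coeff s (f : PowerSeries k) = 0 := by
  have h1 : IsLocalRing.maximalIdeal (ArslanRing k m) ≤
      (Ideal.span {(PowerSeries.X ^ (m * (m + 1)) : PowerSeries k)}).comap
        (semigroupRing k (arslanSemigroup m)).val.toRingHom := by
    intro g hg
    rw [semigroupRing.mem_maximalIdeal_iff] at hg
    rw [Ideal.mem_comap, Ideal.mem_span_singleton, PowerSeries.X_pow_dvd_iff]
    intro s hs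
    by_contra hne
    rw [eq_zero_of_mem_arslanSemigroup_of_lt hm (g.2 s hne) hs] at hne
    exact hne hg
  have h2 := (Ideal.pow_right_mono h1 n).trans (Ideal.le_comap_pow _ n) hf
  rw [Ideal.mem_comap, Ideal.span_singleton_pow, Ideal.mem_span_singleton, ← pow_mul,
    PowerSeries.X_pow_dvd_iff] at h2
  exact h2 s (by rwa [mul_comm])

/-- A choice of generator `γ s` for each exponent `s` in the support sorts the possibly infinite
series into four parts, `f = ∑ t^g φ g`, with each `φ g` of order at least `n n₁`. -/
theorem mem_maximalIdeal_pow_of_coeff_eq_zero (hm : 0 < m) {n : ℕ} {f : ArslanRing k m}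
    (hf : ∀ s < n * (m * (m + 1)), PowerSeries.coeff s (f : PowerSeries k) = 0) :
    f ∈ IsLocalRing.maximalIdeal (ArslanRing k m) ^ n := by
  classical
  induction n generalizing f with
  | zero => simp
  | succ n ih =>
    have h1 : ∀ s, ∃ g, s ∈ arslanSemigroup m → (n + 1) * (m * (m + 1)) ≤ s →
        g ∈ arslanGenerators m ∧ ∃ u ∈ arslanSemigroup m, n * (m * (m + 1)) ≤ u ∧ s = g + u := by
      intro s
      by_cases hs : s ∈ arslanSemigroup m ∧ (n + 1) * (m * (m + 1)) ≤ s
      · obtain ⟨g, h⟩ := exists_generator_add hm hs.1 hs.2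
        exact ⟨g, fun _ _ => h⟩
      · exact ⟨0, fun h h' => absurd ⟨h, h'⟩ hs⟩
    choose γ hγ using h1
    have hγ' : ∀ s, PowerSeries.coeff s (f : PowerSeries k) ≠ 0 →
        γ s ∈ arslanGenerators m ∧ ∃ u ∈ arslanSemigroup m, n * (m * (m + 1)) ≤ u ∧ s = γ s + u :=
      fun s hs => hγ s (f.2 s hs) (not_lt.mp fun h => hs (hf s h))
    let φ : ℕ → PowerSeries k := fun g => PowerSeries.mk fun u =>
      if γ (u + g) = g then PowerSeries.coeff (u + g) (f : PowerSeries k) else 0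
    have hφ : ∀ g u, PowerSeries.coeff u (φ g) ≠ 0 →
        u ∈ arslanSemigroup m ∧ n * (m * (m + 1)) ≤ u := by
      intro g u hu
      simp only [φ, PowerSeries.coeff_mk, ne_eq, ite_eq_right_iff, Classical.not_imp] at hu
      obtain ⟨-, u', hu', hn, h⟩ := hγ' _ hu.2
      obtain rfl : u = u' := by omega
      exact ⟨hu', hn⟩
    let ψ : ℕ → ArslanRing k m := fun g => ⟨φ g, fun u hu => (hφ g u hu).1⟩
    have hf' : f = ∑ g ∈ (arslanGenerators m).attach, semigroupRing.tpow k (arslanSemigroup m) g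
        (mem_arslanSemigroup_of_mem_generators g.2) * ψ g := by
      refine Subtype.ext (PowerSeries.ext fun s => ?_)
      rw [AddSubmonoidClass.coe_finsetSum, map_sum]
      simp only [Subalgebra.coe_mul, semigroupRing.tpow, ψ]
      rw [Finset.sum_attach (arslanGenerators m)
        fun g => PowerSeries.coeff s (PowerSeries.X ^ g * φ g)]
      simp only [PowerSeries.coeff_X_pow_mul', φ, PowerSeries.coeff_mk]
      by_cases hs : PowerSeries.coeff s (f : PowerSeries k) = 0
      · rw [hs, Finset.sum_eq_zero]
        intro g _
        split_ifs with h2 h3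
        · rwa [Nat.sub_add_cancel h2]
        · rfl
        · rfl
      · obtain ⟨h2, u, -, -, h3⟩ := hγ' s hs
        rw [Finset.sum_eq_single_of_mem _ h2]
        · rw [if_pos (by omega), Nat.sub_add_cancel (by omega), if_pos rfl]
        · intro g _ hg
          split_ifs with h4 h5
          · rw [Nat.sub_add_cancel h4] at h5
            exact absurd h5.symm hg
          · rfl
          · rfl
    rw [hf', pow_succ']
    refine sum_mem fun g _ => Ideal.mul_mem_mul ?_ (ih fun s hs => ?_)
    · rw [semigroupRing.mem_maximalIdeal_iff]
      have hg : (g : ℕ) ≠ 0 := by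
        have h2 : 0 < m * (m + 1) := by positivity
        have h3 := g.2
        simp only [arslanGenerators, Finset.mem_insert, Finset.mem_singleton] at h3
        rcases h3 with h3 | h3 | h3 | h3 <;> rw [h3]
        · omega
        · omega
        · positivity
        · positivity
      simp [semigroupRing.tpow, PowerSeries.coeff_X_pow, Ne.symm hg]
    · by_contra hne
      exact absurd (hφ g s hne).2 (not_le.mpr hs)

/-- The powers of the maximal ideal are given by the order of power series. -/
theorem mem_maximalIdeal_pow_iff (hm : 0 < m) {n : ℕ} {f : ArslanRing k m} :
    f ∈ IsLocalRing.maximalIdeal (ArslanRing k m) ^ n ↔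
      ∀ s < n * (m * (m + 1)), PowerSeries.coeff s (f : PowerSeries k) = 0 :=
  ⟨fun hf _ hs => coeff_eq_zero_of_mem_maximalIdeal_pow hm hf hs,
    mem_maximalIdeal_pow_of_coeff_eq_zero hm⟩

theorem mem_arslanIdeal_pow_iff {n : ℕ} {f : ArslanRing k m} :
    f ∈ arslanIdeal k m ^ n ↔
      ∃ g : ArslanRing k m, (f : PowerSeries k) = (g : PowerSeries k) * PowerSeries.X ^ (n * (m * (m + 1))) := by
  rw [arslanIdeal, Ideal.span_singleton_pow, Ideal.mem_span_singleton']
  refine exists_congr fun g => ?_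
  rw [Subtype.ext_iff, eq_comm, mul_comm n, pow_mul]
  rfl

/-- Cancelling `t^(n n₁)` reduces this to the constant term of the cofactor. -/
theorem mem_maximalIdeal_mul_arslanIdeal_pow_iff {n : ℕ} {f : ArslanRing k m}
    (hf : f ∈ arslanIdeal k m ^ n) :
    f ∈ IsLocalRing.maximalIdeal (ArslanRing k m) * arslanIdeal k m ^ n ↔
      PowerSeries.coeff (n * (m * (m + 1))) (f : PowerSeries k) = 0 := by
  obtain ⟨g, hg⟩ := mem_arslanIdeal_pow_iff.mp hf
  have h1 : ∀ z : ArslanRing k m, z * semigroupRing.tpow k (arslanSemigroup m) (m * (m + 1))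
      (AddSubmonoid.subset_closure (by simp)) ^ n = f ↔ z = g := by
    intro z
    rw [Subtype.ext_iff, hg, mul_comm n, pow_mul]
    change (z : PowerSeries k) * (PowerSeries.X ^ (m * (m + 1))) ^ n = _ ↔ _
    rw [mul_left_inj' (pow_ne_zero _ (pow_ne_zero _ PowerSeries.X_ne_zero)), Subtype.ext_iff]
  rw [arslanIdeal, Ideal.span_singleton_pow, Ideal.mem_mul_span_singleton]
  simp only [h1, exists_eq_right]
  rw [semigroupRing.mem_maximalIdeal_iff, hg, PowerSeries.coeff_mul_X_pow', if_pos le_rfl,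
    Nat.sub_self]

end ArslanRing

/-! ### Indexing the basis by digit pairs. -/

/-- The index set of the basis of the tangent cone over the fiber cone. -/
abbrev ArslanIndex (m : ℕ) : Type := (Σ d : Fin m, Fin (2 * (d : ℕ) + 1)) ⊕ Fin m

namespace ArslanIndex

variable {m : ℕ}

/-- The degree of a basis element. -/
def degree : ArslanIndex m → ℕ
  | .inl x => x.1
  | .inr _ => m

/-- The pairs `(p, q)` with `p ≤ m` and `q < m`, listed by the value of `max p q`. -/
def pair : ArslanIndex m → ℕ × ℕ
  | .inl x => if (x.2 : ℕ) ≤ x.1 then (x.1, x.2) else (x.2 - x.1 - 1, x.1)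
  | .inr i => (m, i)

theorem pair_fst_le (i : ArslanIndex m) : i.pair.1 ≤ m := by
  rcases i with ⟨d, i⟩ | i
  · simp only [pair]
    split_ifs <;> simp only <;> omega
  · exact le_rfl

theorem pair_snd_lt (i : ArslanIndex m) : i.pair.2 < m := by
  rcases i with ⟨d, i⟩ | i
  · simp only [pair]
    split_ifs <;> simp only <;> omega
  · exact i.2

/-- For `d < m` the pairs form a hook: `d + 1` of shape `(d, q)` with `q ≤ d`, then `d` of shape
`(p, d)` with `p < d`. -/
theorem degree_eq_max (i : ArslanIndex m) : i.degree = max i.pair.1 i.pair.2 := by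
  rcases i with ⟨d, i⟩ | i
  · simp only [pair, degree]
    split_ifs <;> simp only <;> omega
  · simp only [pair, degree]
    omega

theorem pair_injective : Function.Injective (pair (m := m)) := by
  intro i j h
  have hd : i.degree = j.degree := by rw [degree_eq_max, degree_eq_max, h]
  rcases i with ⟨d, i⟩ | i <;> rcases j with ⟨e, j⟩ | j
  · obtain rfl : d = e := Fin.ext hd
    obtain rfl : i = j := by
      simp only [pair] at h
      split_ifs at h <;> simp only [Prod.mk.injEq] at h <;> omega
    rfl
  · simp only [degree] at hd
    omega
  · simp only [degree] at hd
    omega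
  · simp only [pair, Prod.mk.injEq, Fin.val_inj] at h
    rw [h.2]

theorem exists_pair_eq {p q : ℕ} (hp : p ≤ m) (hq : q < m) :
    ∃ i : ArslanIndex m, i.pair = (p, q) := by
  rcases hp.lt_or_eq with hp | rfl
  · rcases le_or_gt q p with h | h
    · refine ⟨.inl ⟨⟨p, hp⟩, ⟨q, by simp only; omega⟩⟩, ?_⟩
      simp [pair, h]
    · refine ⟨.inl ⟨⟨q, hq⟩, ⟨p + q + 1, by simp only; omega⟩⟩, ?_⟩
      simp only [pair]
      rw [if_neg (by omega), Prod.mk.injEq]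
      omega
  · exact ⟨.inr ⟨q, hq⟩, rfl⟩

/-- The element of degree `n` of the class of numbers modulo `m (m + 1)` that belongs to an
index. -/
def number (i : ArslanIndex m) (n : ℕ) : ℕ := arslanNumber m n i.pair.1 i.pair.2

theorem number_mem_iff (i : ArslanIndex m) (n : ℕ) :
    i.number n ∈ arslanSemigroup m ↔ i.degree ≤ n := by
  rw [number, arslanNumber_mem_iff i.pair_fst_le i.pair_snd_lt, degree_eq_max, max_le_iff]

theorem number_lt_iff (i : ArslanIndex m) (n N : ℕ) :
    i.number n < N * (m * (m + 1)) ↔ n < N :=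
  arslanNumber_lt_iff i.pair_fst_le i.pair_snd_lt N

theorem number_injective_left {n : ℕ} {i j : ArslanIndex m} (h : i.number n = j.number n) :
    i = j := by
  have h1 := arslanNumber_inj i.pair_fst_le i.pair_snd_lt j.pair_fst_le j.pair_snd_lt h
  exact pair_injective (Prod.ext h1.2.1 h1.2.2)

theorem number_add (i : ArslanIndex m) (a b : ℕ) :
    i.number (a + b) = a * (m * (m + 1)) + i.number b := by
  unfold number arslanNumber
  ring

theorem exists_eq_number (hm : 0 < m) (s : ℕ) : ∃ (i : ArslanIndex m) (n : ℕ), s = i.number n := by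
  obtain ⟨n, p, q, hp, hq, rfl⟩ := exists_eq_arslanNumber hm s
  obtain ⟨i, hi⟩ := exists_pair_eq hp hq
  exact ⟨i, n, by rw [number, hi]⟩

end ArslanIndex

/-! ### The combination map from the free module to the tangent cone. -/

namespace ArslanRing

open IsLocalRing

variable {k : Type*} [Field k] {m : ℕ}

theorem coeff_coe_sub (s : ℕ) (a b : ArslanRing k m) :
    PowerSeries.coeff s ((a - b : ArslanRing k m) : PowerSeries k) =
      PowerSeries.coeff s (a : PowerSeries k) - PowerSeries.coeff s (b : PowerSeries k) :=
  map_sub (PowerSeries.coeff s) (a : PowerSeries k) (b : PowerSeries k)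

theorem coeff_eq_zero_of_lt_degree (f : ArslanRing k m) {i : ArslanIndex m} {n : ℕ}
    (h : n < i.degree) : PowerSeries.coeff (i.number n) (f : PowerSeries k) = 0 := by
  by_contra hne
  exact absurd ((i.number_mem_iff n).mp (f.2 _ hne)) (not_le.mpr h)

theorem mem_maximalIdeal_pow_succ_iff (hm : 0 < m) {n : ℕ} {f : ArslanRing k m}
    (hf : f ∈ maximalIdeal (ArslanRing k m) ^ n) :
    f ∈ maximalIdeal (ArslanRing k m) * maximalIdeal (ArslanRing k m) ^ n ↔
      ∀ i : ArslanIndex m, PowerSeries.coeff (i.number n) (f : PowerSeries k) = 0 := by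
  rw [← pow_succ', mem_maximalIdeal_pow_iff hm]
  rw [mem_maximalIdeal_pow_iff hm] at hf
  constructor
  · exact fun h i => h _ ((i.number_lt_iff n _).mpr n.lt_succ_self)
  · intro h s hs
    obtain ⟨i, j, rfl⟩ := ArslanIndex.exists_eq_number hm s
    rcases (Nat.lt_succ_iff.mp ((i.number_lt_iff j _).mp hs)).lt_or_eq with hj | rfl
    · exact hf _ ((i.number_lt_iff j n).mpr hj)
    · exact h i

/-- With `h = g t^(a n₁)` the product is `g t^(i.number n)`. Since `i.number n` and `j.number n` lie
in one interval of length `n₁`, only the constant term of `g` can contribute. -/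
theorem coeff_mul_X_pow_number (hm : 0 < m) {n a : ℕ} {h : ArslanRing k m}
    (hh : h ∈ arslanIdeal k m ^ a) (i j : ArslanIndex m) (hn : a + i.degree = n) :
    PowerSeries.coeff (j.number n)
      ((h : PowerSeries k) * PowerSeries.X ^ i.number i.degree) =
      if i = j then PowerSeries.coeff (a * (m * (m + 1))) (h : PowerSeries k) else 0 := by
  obtain ⟨g, hg⟩ := mem_arslanIdeal_pow_iff.mp hh
  rw [hg, mul_assoc, ← pow_add, ← ArslanIndex.number_add, hn, PowerSeries.coeff_mul_X_pow',
    PowerSeries.coeff_mul_X_pow', if_pos le_rfl, Nat.sub_self]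
  by_cases hij : i = j
  · subst hij
    rw [if_pos le_rfl, if_pos rfl, Nat.sub_self]
  · rw [if_neg hij, ite_eq_right_iff]
    intro hle
    by_contra hne
    have h1 : ¬ i.number n < n * (m * (m + 1)) := fun h => lt_irrefl n ((i.number_lt_iff n n).mp h)
    have h2 := (j.number_lt_iff n (n + 1)).mpr n.lt_succ_self
    rw [add_mul, one_mul] at h2
    have h3 := eq_zero_of_mem_arslanSemigroup_of_lt hm (g.2 _ hne) (by omega)
    exact hij (ArslanIndex.number_injective_left (n := n) (by omega))

/-- The lift `t^w T^d` to the Rees algebra of a basis element of the tangent cone. -/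
noncomputable def reesBasis (k : Type*) [Field k] (hm : 0 < m) (i : ArslanIndex m) :
    reesAlgebra (maximalIdeal (ArslanRing k m)) :=
  ⟨monomial i.degree (semigroupRing.tpow k (arslanSemigroup m) (i.number i.degree)
      ((i.number_mem_iff _).mpr le_rfl)), by
    rw [reesAlgebra.monomial_mem, mem_maximalIdeal_pow_iff hm]
    intro s hs
    have h1 : ¬ i.number i.degree < i.degree * (m * (m + 1)) :=
      fun h => lt_irrefl _ ((i.number_lt_iff _ _).mp h)
    simp only [semigroupRing.tpow, PowerSeries.coeff_X_pow]
    exact if_neg (by omega)⟩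

theorem coeff_sum_mul_reesBasis (hm : 0 < m) (hI : arslanIdeal k m ≤ maximalIdeal (ArslanRing k m))
    (f : ArslanIndex m → reesAlgebra (arslanIdeal k m)) (n : ℕ) (j : ArslanIndex m) :
    PowerSeries.coeff (j.number n) (((∑ i, Subalgebra.inclusion (reesAlgebra_le_of_le hI) (f i) *
        reesBasis k hm i : reesAlgebra (maximalIdeal (ArslanRing k m))) :
          (ArslanRing k m)[X]).coeff n : PowerSeries k) =
      if j.degree ≤ n then PowerSeries.coeff ((n - j.degree) * (m * (m + 1)))
        ((f j : (ArslanRing k m)[X]).coeff (n - j.degree) : PowerSeries k) else 0 := by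
  have h1 : ∀ i : ArslanIndex m, PowerSeries.coeff (j.number n)
      (((f i : (ArslanRing k m)[X]) * (reesBasis k hm i : (ArslanRing k m)[X])).coeff n :
        PowerSeries k) = if i = j then (if j.degree ≤ n then
          PowerSeries.coeff ((n - j.degree) * (m * (m + 1)))
          ((f j : (ArslanRing k m)[X]).coeff (n - j.degree) : PowerSeries k) else 0) else 0 := by
    intro i
    change PowerSeries.coeff (j.number n) ((((f i : (ArslanRing k m)[X]) * monomial i.degree
      (semigroupRing.tpow k (arslanSemigroup m) (i.number i.degree)
        ((i.number_mem_iff _).mpr le_rfl))).coeff n : ArslanRing k m) : PowerSeries k) = _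
    rw [← C_mul_X_pow_eq_monomial, ← mul_assoc, coeff_mul_X_pow', coeff_mul_C]
    by_cases hi : i.degree ≤ n
    · rw [if_pos hi]
      refine (coeff_mul_X_pow_number hm ((mem_reesAlgebra_iff _ _).mp (f i).2 _) i j
        (Nat.sub_add_cancel hi)).trans ?_
      by_cases hij : i = j
      · subst hij
        simp only [if_true, if_pos hi]
      · simp only [if_neg hij]
    · rw [if_neg hi]
      by_cases hij : i = j
      · subst hij
        simp [if_neg hi]
      · simp [if_neg hij]
  rw [AddSubmonoidClass.coe_finsetSum, finsetSum_coeff, AddSubmonoidClass.coe_finsetSum, map_sum]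
  exact (Finset.sum_congr rfl fun i _ => h1 i).trans (by simp)

/-- Realized by `∑ c i t^(i n₁) Tⁱ`; this supplies the preimages for surjectivity. -/
theorem exists_reesAlgebra_coeff_eq (c : ℕ → k) {N : ℕ} (hc : ∀ n, N < n → c n = 0) :
    ∃ f : reesAlgebra (arslanIdeal k m), ∀ n, PowerSeries.coeff (n * (m * (m + 1)))
      ((f : (ArslanRing k m)[X]).coeff n : PowerSeries k) = c n := by
  let t : ArslanRing k m := semigroupRing.tpow k (arslanSemigroup m) (m * (m + 1))
    (AddSubmonoid.subset_closure (by simp))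
  have h1 : ∀ n, (∑ i ∈ Finset.range (N + 1), monomial i (c i • t ^ i)).coeff n = c n • t ^ n := by
    intro n
    rw [finsetSum_coeff]
    simp only [coeff_monomial, Finset.sum_ite_eq', Finset.mem_range]
    split_ifs with h
    · rfl
    · rw [hc n (by omega), zero_smul]
  refine ⟨⟨∑ i ∈ Finset.range (N + 1), monomial i (c i • t ^ i), ?_⟩, fun n => ?_⟩
  · rw [mem_reesAlgebra_iff]
    intro n
    rw [h1, Algebra.smul_def]
    exact Ideal.mul_mem_left _ _ (Ideal.pow_mem_pow (Ideal.mem_span_singleton_self t) n)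
  · simp only [h1]
    change PowerSeries.coeff _ (c n • (PowerSeries.X ^ (m * (m + 1))) ^ n) = c n
    rw [← pow_mul, mul_comm n]
    simp [PowerSeries.coeff_X_pow]

theorem fiberCone_mem_component_iff (N : ℤ) (f : reesAlgebra (arslanIdeal k m)) :
    ReesQuotient.mk (maximalIdeal (ArslanRing k m)) (arslanIdeal k m) f ∈
        FiberCone.component (arslanIdeal k m) N ↔
      ∀ n : ℕ, (n : ℤ) ≠ N → PowerSeries.coeff (n * (m * (m + 1)))
        ((f : (ArslanRing k m)[X]).coeff n : PowerSeries k) = 0 := by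
  rw [FiberCone.component, ReesQuotient.mk_mem_component_iff]
  exact forall_congr' fun n => imp_congr_right fun _ =>
    mem_maximalIdeal_mul_arslanIdeal_pow_iff ((mem_reesAlgebra_iff _ _).mp f.2 n)

theorem tangentCone_mem_component_iff (hm : 0 < m) (N : ℤ)
    (f : reesAlgebra (maximalIdeal (ArslanRing k m))) :
    ReesQuotient.mk (maximalIdeal (ArslanRing k m)) (maximalIdeal (ArslanRing k m)) f ∈
        TangentCone.component (ArslanRing k m) N ↔
      ∀ n : ℕ, (n : ℤ) ≠ N → ∀ i : ArslanIndex m, PowerSeries.coeff (i.number n)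
        ((f : (ArslanRing k m)[X]).coeff n : PowerSeries k) = 0 := by
  rw [TangentCone.component, ReesQuotient.mk_mem_component_iff]
  exact forall_congr' fun n => imp_congr_right fun _ =>
    mem_maximalIdeal_pow_succ_iff hm ((mem_reesAlgebra_iff _ _).mp f.2 n)

theorem tangentCone_mk_eq_mk (hm : 0 < m) {f g : reesAlgebra (maximalIdeal (ArslanRing k m))}
    (h : ∀ (n : ℕ) (i : ArslanIndex m),
      PowerSeries.coeff (i.number n) ((f : (ArslanRing k m)[X]).coeff n : PowerSeries k) =
        PowerSeries.coeff (i.number n) ((g : (ArslanRing k m)[X]).coeff n : PowerSeries k)) :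
    ReesQuotient.mk (maximalIdeal (ArslanRing k m)) (maximalIdeal (ArslanRing k m)) f =
      ReesQuotient.mk _ _ g := by
  rw [ReesQuotient.mk_eq_mk_iff]
  intro n
  have hf := (mem_reesAlgebra_iff _ _).mp f.2 n
  have hg := (mem_reesAlgebra_iff _ _).mp g.2 n
  rw [mem_maximalIdeal_pow_succ_iff hm (sub_mem hf hg)]
  intro i
  rw [coeff_coe_sub, h n i, sub_self]

/-- The linear combination of the basis elements of the tangent cone with coefficients in the
fiber cone. -/
noncomputable def tangentConeCombination (hm : 0 < m)
    (hI : arslanIdeal k m ≤ maximalIdeal (ArslanRing k m)) :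
    letI : Algebra (FiberCone (arslanIdeal k m)) (TangentCone (ArslanRing k m)) :=
      TangentCone.algebraFiberCone hI
    (ArslanIndex m → FiberCone (arslanIdeal k m)) →ₗ[FiberCone (arslanIdeal k m)]
      TangentCone (ArslanRing k m) :=
  letI : Algebra (FiberCone (arslanIdeal k m)) (TangentCone (ArslanRing k m)) :=
    TangentCone.algebraFiberCone hI
  Fintype.linearCombination _ fun i => ReesQuotient.mk _ _ (reesBasis k hm i)

theorem tangentConeCombination_mk (hm : 0 < m)
    (hI : arslanIdeal k m ≤ maximalIdeal (ArslanRing k m))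
    (f : ArslanIndex m → reesAlgebra (arslanIdeal k m)) :
    tangentConeCombination hm hI (fun i => ReesQuotient.mk _ _ (f i)) =
      ReesQuotient.mk _ _ (∑ i, Subalgebra.inclusion (reesAlgebra_le_of_le hI) (f i) *
        reesBasis k hm i) := by
  let _ : Algebra (FiberCone (arslanIdeal k m)) (TangentCone (ArslanRing k m)) :=
    TangentCone.algebraFiberCone hI
  rw [map_sum]
  simp only [map_mul]
  rfl

theorem tangentConeCombination_mem_component_iff (hm : 0 < m)
    (hI : arslanIdeal k m ≤ maximalIdeal (ArslanRing k m)) (N : ℤ)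
    (c : ArslanIndex m → FiberCone (arslanIdeal k m)) :
    tangentConeCombination hm hI c ∈ TangentCone.component (ArslanRing k m) N ↔
      ∀ i, c i ∈ FiberCone.component (arslanIdeal k m) (N - i.degree) := by
  choose f hf using fun i => ReesQuotient.mk_surjective _ _ (c i)
  obtain rfl : (fun i => ReesQuotient.mk _ _ (f i)) = c := funext hf
  rw [tangentConeCombination_mk, tangentCone_mem_component_iff hm]
  simp only [fiberCone_mem_component_iff]
  constructor
  · intro h i n hn
    have h1 := h (n + i.degree) (by push_cast; omega) i
    rw [coeff_sum_mul_reesBasis hm hI] at h1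
    rwa [if_pos (Nat.le_add_left _ _), Nat.add_sub_cancel] at h1
  · intro h n hn i
    rw [coeff_sum_mul_reesBasis hm hI]
    split_ifs with hi
    · exact h i _ (by omega)
    · rfl

theorem tangentConeCombination_bijective (hm : 0 < m)
    (hI : arslanIdeal k m ≤ maximalIdeal (ArslanRing k m)) :
    Function.Bijective (tangentConeCombination hm hI) := by
  let _ : Algebra (FiberCone (arslanIdeal k m)) (TangentCone (ArslanRing k m)) :=
    TangentCone.algebraFiberCone hI
  constructor
  · rw [injective_iff_map_eq_zero]
    intro c hc
    funext i
    have h1 : ∀ N, c i ∈ FiberCone.component (arslanIdeal k m) (N - i.degree) := fun N =>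
      (tangentConeCombination_mem_component_iff hm hI N c).mp (by rw [hc]; exact zero_mem _) i
    -- Zero is homogeneous of every degree, in particular of degree `-1`; this places `c i` in a
    -- component of negative degree, which is trivial.
    have h2 := h1 (-1)
    rwa [FiberCone.component, ReesQuotient.component, if_neg (by omega),
      AddSubgroup.mem_bot] at h2
  · intro x
    obtain ⟨g, rfl⟩ := ReesQuotient.mk_surjective _ _ x
    have h1 : ∀ i : ArslanIndex m, ∃ f : reesAlgebra (arslanIdeal k m), ∀ n,
        PowerSeries.coeff (n * (m * (m + 1)))
          ((f : (ArslanRing k m)[X]).coeff n : PowerSeries k) =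
        PowerSeries.coeff (i.number (n + i.degree))
          ((g : (ArslanRing k m)[X]).coeff (n + i.degree) : PowerSeries k) := by
      intro i
      -- The coordinates of `g` along `i`, shifted by the degree of `i`, vanish beyond the degree of
      -- `g`.
      refine exists_reesAlgebra_coeff_eq _ (N := (g : (ArslanRing k m)[X]).natDegree) ?_
      intro n hn
      rw [coeff_eq_zero_of_natDegree_lt (by omega)]
      simp
    choose f hf using h1
    refine ⟨fun i => ReesQuotient.mk _ _ (f i), ?_⟩
    rw [tangentConeCombination_mk]
    refine tangentCone_mk_eq_mk hm fun n i => ?_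
    rw [coeff_sum_mul_reesBasis hm hI]
    split_ifs with hi
    · rw [hf, Nat.sub_add_cancel hi]
    -- Below the degree of `i` the exponent is a gap of the semigroup, so `g` has no coefficient
    -- there.
    · exact (coeff_eq_zero_of_lt_degree _ (not_le.mp hi)).symm

end ArslanRing

/-! ### Freeness and the graded decomposition. -/

theorem mainTheorem3 (k : Type*) [Field k] (m : ℕ) (hm : 2 ≤ m) :
    letI : Algebra (FiberCone (arslanIdeal k m)) (TangentCone (ArslanRing k m)) :=
      TangentCone.algebraFiberCone (arslanIdeal_le k hm)
    Module.Free (FiberCone (arslanIdeal k m)) (TangentCone (ArslanRing k m)) ∧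
    Nonempty (GradedModuleEquiv (FiberCone (arslanIdeal k m))
      (M := (∀ d : Fin m, Fin (2 * (d : ℕ) + 1) → FiberCone (arslanIdeal k m)) ×
        (Fin m → FiberCone (arslanIdeal k m)))
      (N := TangentCone (ArslanRing k m))
      (gradingProd
        (gradingPi fun d : Fin m => gradingPi fun _ : Fin (2 * (d : ℕ) + 1) =>
          gradingShift (FiberCone.component (arslanIdeal k m)) (-((d : ℕ) : ℤ)))
        (gradingPi fun _ : Fin m =>
          gradingShift (FiberCone.component (arslanIdeal k m)) (-(m : ℤ))))
      (TangentCone.component (ArslanRing k m))) := by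
  let _ : Algebra (FiberCone (arslanIdeal k m)) (TangentCone (ArslanRing k m)) :=
    TangentCone.algebraFiberCone (arslanIdeal_le k hm)
  have hm0 : 0 < m := by omega
  let Φ : (ArslanIndex m → FiberCone (arslanIdeal k m)) ≃ₗ[FiberCone (arslanIdeal k m)]
      TangentCone (ArslanRing k m) :=
    LinearEquiv.ofBijective (ArslanRing.tangentConeCombination hm0 (arslanIdeal_le k hm))
      (ArslanRing.tangentConeCombination_bijective hm0 (arslanIdeal_le k hm))
  refine ⟨Module.Free.of_equiv Φ, ⟨?_⟩⟩
  -- Pure reindexing: the sum type is split and the sigma type curried.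
  let Ψ : (ArslanIndex m → FiberCone (arslanIdeal k m)) ≃ₗ[FiberCone (arslanIdeal k m)]
      (∀ d : Fin m, Fin (2 * (d : ℕ) + 1) → FiberCone (arslanIdeal k m)) ×
        (Fin m → FiberCone (arslanIdeal k m)) :=
    (LinearEquiv.sumArrowLequivProdArrow _ _ _ _).trans
      ((LinearEquiv.piCurry _ fun _ _ => FiberCone (arslanIdeal k m)).prodCongr
        (LinearEquiv.refl _ _))
  refine { Ψ.symm.trans Φ with mem_iff := ?_ }
  intro N x
  obtain ⟨c, rfl⟩ := Ψ.surjective x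
  have h1 : (Ψ.symm.trans Φ) (Ψ c) =
      ArslanRing.tangentConeCombination hm0 (arslanIdeal_le k hm) c := by
    rw [LinearEquiv.trans_apply, LinearEquiv.symm_apply_apply]
    rfl
  change (Ψ.symm.trans Φ) (Ψ c) ∈ _ ↔ _
  rw [h1, ArslanRing.tangentConeCombination_mem_component_iff, Sum.forall, Sigma.forall]
  simp only [gradingProd, gradingPi, gradingShift, AddSubgroup.mem_prod, AddSubgroup.mem_pi,
    Set.mem_univ, true_imp_iff, ← sub_eq_add_neg]
  rfl
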